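/- Let $\mathcal K$ be a field, let $<$ be an admissible monomial order on $\mathcal K[x_1,\dots,x_n]$, and let $f_1,\dots,f_m\in\mathcal K[x_1,\dots,x_n]$ be nonzero homogeneous polynomials. Consider Faugère's original F5 algorithm on this input. It produces a sequence $r_1,r_2,\dots$ of labeled polynomials, where $r_k$ consists of a polynomial $\mathrm{poly}(r_k)$ and a signature $\mathcal S(r_k)=t\,\mathbf F_i$ ($t$ a monomial, $1\le i\le m$). Signatures are ordered by $t\,\mathbf F_i\prec t'\,\mathbf F_j$ iff $i>j$, or $i=j$ and $t<t'$; and $t\,\mathbf F_i$ divides $t'\,\mathbf F_j$ iff $i=j$ and $t\mid t'$. The first $m$ labeled polynomials are the (monic) input polynomials, $r_k=(\mathbf F_k,f_k)$. Every later $r_l$ is created, in the procedure Spol or in the procedure TopReduction, as an S-polynomial $$\mathrm{poly}(r_l)=\overline u\,\mathrm{poly}(r_{l^*})-c\,\underline u\,\mathrm{poly}(r_{l_*}),\qquad \mathcal S(r_l)=\overline u\,\mathcal S(r_{l^*})\succ\underline u\,\mathcal S(r_{l_*}),$$ of two earlier elements (polynomial parts taken at the moment of creation; $\overline u,\underline u$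 monomials and $c\in\mathcal K\setminus\{0\}$ such that both products have the same leading term, whose monomial is the least common multiple of the two leading monomials). The polynomial part of $r_l$ may later be reduced, but its signature never changes. An infinite S-pair-chain of an execution is an infinite subsequence $h_0=r_{k_0},\,h_1=r_{k_1},\dots$ (with $k_0<k_1<\cdots$) of the sequence of generated labeled polynomials such that for every $a\ge 0$ the element $h_{a+1}$ was generated as an S-polynomial whose part of greater signature is a monomial multiple of $h_a$, i.e. $k_{a+1}^*=k_a$; in particular $\mathcal S(h_a)\mid\mathcal S(h_{a+1})$. Theorem. If the algorithm does not terminate on the input $f_1,\dots,f_m$, i.e. if it has an infinite execution, then there exists an infinite S-pair-chain $\{h_a\}_{a\ge0}$ in that execution. -/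

import Mathlib

namespace F5

/-- A signature `x^mon · F_idx`. The input polynomials are numbered from `0`. -/
@[ext]
structure Sig (n : ℕ) where
  mon : Fin n →₀ ℕ
  idx : ℕ

/-- The product of a signature with the monomial `x^u`. -/
noncomputable def Sig.mul {n : ℕ} (u : Fin n →₀ ℕ) (S : Sig n) : Sig n := ⟨u + S.mon, S.idx⟩

/-- Divisibility of signatures: same index and divisibility of the monomials. -/
def Sig.Dvd {n : ℕ} (S T : Sig n) : Prop := ∃ u : Fin n →₀ ℕ, T = S.mul u

/-- The order on signatures: `x^a F_i ≺ x^b F_j` iff `i > j`, or `i = j` and `x^a < x^b`. -/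
def Sig.Lt {n : ℕ} (ord : MonomialOrder (Fin n)) (S T : Sig n) : Prop :=
  T.idx < S.idx ∨ (S.idx = T.idx ∧ ord.toSyn S.mon < ord.toSyn T.mon)

/-- A labeled polynomial: a signature together with a polynomial. -/
structure LabeledPoly (n : ℕ) (K : Type*) [Field K] where
  sig : Sig n
  poly : MvPolynomial (Fin n) K

/-- The global data of the algorithm: the number `N` of labeled polynomials generated so far, the
array `r` of labeled polynomials (the entries at positions `< N` are the meaningful ones), and the
lists `rule i` of simplification rules of index `i`, newest rule first. A rule `(t, k)` says that
`r k` was generated with signature `t · F_i`. -/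
structure Mem (n : ℕ) (K : Type*) [Field K] where
  N : ℕ
  r : ℕ → LabeledPoly n K
  rule : ℕ → List ((Fin n →₀ ℕ) × ℕ)

section

variable {n : ℕ} {K : Type*} [Field K]

/-- Signature of the `k`-th labeled polynomial. -/
def Mem.S (M : Mem n K) (k : ℕ) : Sig n := (M.r k).sig

/-- Polynomial part of the `k`-th labeled polynomial. -/
def Mem.poly (M : Mem n K) (k : ℕ) : MvPolynomial (Fin n) K := (M.r k).poly

/-- Overwrite the polynomial part of the `k`-th labeled polynomial; the signature is kept. -/
def Mem.setPoly (M : Mem n K) (k : ℕ) (p : MvPolynomial (Fin n) K) : Mem n K :=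
  { M with r := Function.update M.r k ⟨M.S k, p⟩ }

/-- Append a new labeled polynomial at position `N` and add the corresponding rule as the newest
rule of its index. -/
def Mem.push (M : Mem n K) (S : Sig n) (p : MvPolynomial (Fin n) K) : Mem n K where
  N := M.N + 1
  r := Function.update M.r M.N ⟨S, p⟩
  rule := Function.update M.rule S.idx ((S.mon, M.N) :: M.rule S.idx)

open Classical in
/-- `Rewrite`: the position of the newest labeled polynomial having a rule whose signature divides
`x^u · S(r_k)`, and `k` itself if there is no such rule. -/
noncomputable def Mem.rewrite (M : Mem n K) (u : Fin n →₀ ℕ) (k : ℕ) : ℕ :=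
  match (M.rule (M.S k).idx).find? (fun x => decide (x.1 ≤ u + (M.S k).mon)) with
  | some x => x.2
  | none => k

/-- The test `Rewritten?(x^u, r_k)`. -/
def Mem.Rewritten (M : Mem n K) (u : Fin n →₀ ℕ) (k : ℕ) : Prop := M.rewrite u k ≠ k

/-- `q` is a normal form of `p` modulo `B` (a complete remainder of the division of `p` by `B`). -/
def IsNormalForm (ord : MonomialOrder (Fin n)) (B : Set (MvPolynomial (Fin n) K))
    (p q : MvPolynomial (Fin n) K) : Prop :=
  (∃ g : B →₀ MvPolynomial (Fin n) K,
    p = Finsupp.linearCombination (MvPolynomial (Fin n) K)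
        (fun b : B => (b : MvPolynomial (Fin n) K)) g + q ∧
    ∀ b : B, ord.toSyn (ord.degree ((b : MvPolynomial (Fin n) K) * g b))
      ≤ ord.toSyn (ord.degree p)) ∧
  ∀ c ∈ q.support, ∀ b ∈ B, ¬ ord.degree b ≤ c

/-- The polynomial parts of the labeled polynomials at the positions in `G`. -/
def Mem.polys (M : Mem n K) (G : List ℕ) : Set (MvPolynomial (Fin n) K) :=
  {p | ∃ j ∈ G, M.poly j = p}

/-- The test `φ(x^t) = x^t`, where `φ` is the normal form operator modulo the list `prev`. -/
def Mem.IsNormalMon (ord : MonomialOrder (Fin n)) (M : Mem n K) (prev : List ℕ)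
    (t : Fin n →₀ ℕ) : Prop :=
  IsNormalForm ord (M.polys prev) (MvPolynomial.monomial t 1) (MvPolynomial.monomial t 1)

/-- A critical pair `[t, u, r_hi, v, r_lo]`. -/
structure CPair (n : ℕ) where
  t : Fin n →₀ ℕ
  u : Fin n →₀ ℕ
  hi : ℕ
  v : Fin n →₀ ℕ
  lo : ℕ

open Classical in
/-- The critical pair of `r_a` and `r_b` with the part of greater signature in first place. -/
noncomputable def Mem.orientedPair (ord : MonomialOrder (Fin n)) (M : Mem n K) (a b : ℕ) :
    CPair n :=
  let t := ord.degree (M.poly a) ⊔ ord.degree (M.poly b)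
  let u := t - ord.degree (M.poly a)
  let v := t - ord.degree (M.poly b)
  if Sig.Lt ord ((M.S a).mul u) ((M.S b).mul v) then ⟨t, v, b, u, a⟩ else ⟨t, u, a, v, b⟩

open Classical in
/-- `CritPair`: returns nothing if the part of greater signature has index different from the
current index `k` (the larger index belongs to an earlier call) or if one of the parts of index
`k` is not normalized with respect to the output `prev` of the preceding call. -/
noncomputable def Mem.critPair (ord : MonomialOrder (Fin n)) (M : Mem n K) (k : ℕ)
    (prev : List ℕ) (a b : ℕ) : Option (CPair n) :=
  let p := M.orientedPair ord a b
  if k < (M.S p.hi).idx then none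
  else if ¬ M.IsNormalMon ord prev (p.u + (M.S p.hi).mon) then none
  else if (M.S p.lo).idx = k ∧ ¬ M.IsNormalMon ord prev (p.v + (M.S p.lo).mon) then none
  else some p

/-- The `for` loop that moves the elements of the first list (the result of `Reduction`) one by one
to `G`, collecting the new critical pairs. -/
noncomputable def Mem.addAll (ord : MonomialOrder (Fin n)) (M : Mem n K) (k : ℕ)
    (prev : List ℕ) : List ℕ → List ℕ → List (CPair n) → List ℕ × List (CPair n)
  | [], G, P => (G, P)
  | a :: Rd, G, P =>
      M.addAll ord k prev Rd (G ++ [a]) (P ++ G.filterMap (M.critPair ord k prev a))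

/-- `IsReducible`: `r_j`, with `j ∈ L`, is an admissible top-reductor of the labeled polynomial with
signature `S` and polynomial part `q ≠ 0`. -/
def Mem.IsReductor (ord : MonomialOrder (Fin n)) (M : Mem n K) (prev L : List ℕ) (S : Sig n)
    (q : MvPolynomial (Fin n) K) (j : ℕ) : Prop :=
  j ∈ L ∧
  ord.degree (M.poly j) ≤ ord.degree q ∧
  M.IsNormalMon ord prev ((ord.degree q - ord.degree (M.poly j)) + (M.S j).mon) ∧
  ¬ M.Rewritten (ord.degree q - ord.degree (M.poly j)) j ∧
  (M.S j).mul (ord.degree q - ord.degree (M.poly j)) ≠ S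

end

/-- The data fixed or accumulated during one call of `AlgorithmF5`: the index of the treated input
polynomial, the output `prev` of the preceding call, and the current set `G`. Labeled polynomials
are referred to by their positions. -/
structure Call where
  idx : ℕ
  prev : List ℕ
  G : List ℕ

/-- The control points of the algorithm. -/
inductive Phase (n : ℕ) where
  /-- The outer loop: the input polynomials with index `< i` are still to be treated and `G` is the
  result so far. -/
  | outer (i : ℕ) (G : List ℕ)
  /-- The head of the `while` loop of `AlgorithmF5` with set of critical pairs `P`. -/
  | loop (c : Call) (P : List (CPair n))
  /-- Inside `Spol`: the pairs in `Q` are still to be treated, `F` is the output so far. -/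
  | spol (c : Call) (P Q : List (CPair n)) (F : List ℕ)
  /-- The head of the `while` loop of `Reduction`. -/
  | red (c : Call) (P : List (CPair n)) (todo done : List ℕ)
  /-- The algorithm has returned `G`. -/
  | halt (G : List ℕ)

structure State (n : ℕ) (K : Type*) [Field K] where
  mem : Mem n K
  phase : Phase n

/-- The record of the generation of `r_new` as the S-polynomial with parts `x^u · r_hi` and
`x^v · r_lo`, of which `x^u · r_hi` determines the signature. -/
structure Gen (n : ℕ) where
  new : ℕ
  u : Fin n →₀ ℕ
  hi : ℕ
  v : Fin n →₀ ℕ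
  lo : ℕ

section

variable {n : ℕ} {K : Type*} [Field K]

open Classical in
/-- One step of the algorithm. The `Option (Gen n)` component records the S-polynomial generated in
the step, if there is one. Choices that do not matter for the algorithm (the order in which pairs of
the same degree are treated, which admissible reductor or which normal form is taken) are left open,
so that every way of resolving them is covered. -/
inductive Step (ord : MonomialOrder (Fin n)) :
    State n K → Option (Gen n) → State n K → Prop
  /-- Start of `AlgorithmF5` for the input polynomial `i`. -/
  | call (M : Mem n K) (i : ℕ) (G : List ℕ) :
      Step ord ⟨M, .outer (i + 1) G⟩ none
        ⟨M, .loop ⟨i, G, G ++ [i]⟩ (G.filterMap (M.critPair ord i G i))⟩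
  /-- All input polynomials are treated. -/
  | finish (M : Mem n K) (G : List ℕ) :
      Step ord ⟨M, .outer 0 G⟩ none ⟨M, .halt G⟩
  /-- The algorithm may return early when the polynomial `1` was found. -/
  | unit (M : Mem n K) (i : ℕ) (G : List ℕ) (j : ℕ) (hj : j ∈ G) (h1 : M.poly j = 1) :
      Step ord ⟨M, .outer i G⟩ none ⟨M, .halt [j]⟩
  /-- No critical pairs are left: `AlgorithmF5` returns. -/
  | ret (M : Mem n K) (c : Call) :
      Step ord ⟨M, .loop c []⟩ none ⟨M, .outer c.idx c.G⟩
  /-- All critical pairs of the minimal degree `d` are moved from `P` to `Spol`. -/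
  | select (M : Mem n K) (c : Call) (P Q : List (CPair n)) (d : ℕ)
      (hd : ∃ p ∈ P, p.t.degree = d) (hmin : ∀ p ∈ P, d ≤ p.t.degree)
      (hQ : Q.Perm (P.filter (fun p => decide (p.t.degree = d)))) :
      Step ord ⟨M, .loop c P⟩ none
        ⟨M, .spol c (P.filter (fun p => decide (p.t.degree ≠ d))) Q []⟩
  /-- `Spol` discards a pair one of whose parts is rewritten. -/
  | spolSkip (M : Mem n K) (c : Call) (P Q : List (CPair n)) (F : List ℕ) (p : CPair n)
      (h : M.Rewritten p.u p.hi ∨ M.Rewritten p.v p.lo) :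
      Step ord ⟨M, .spol c P (p :: Q) F⟩ none ⟨M, .spol c P Q F⟩
  /-- `Spol` generates an S-polynomial. -/
  | spolNew (M : Mem n K) (c : Call) (P Q : List (CPair n)) (F : List ℕ) (p : CPair n)
      (h₁ : ¬ M.Rewritten p.u p.hi) (h₂ : ¬ M.Rewritten p.v p.lo) :
      Step ord ⟨M, .spol c P (p :: Q) F⟩ (some ⟨M.N, p.u, p.hi, p.v, p.lo⟩)
        ⟨M.push ((M.S p.hi).mul p.u)
            (MvPolynomial.monomial p.u 1 * M.poly p.hi -
              MvPolynomial.monomial p.v 1 * M.poly p.lo),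
          .spol c P Q (F ++ [M.N])⟩
  /-- `Spol` returns and `Reduction` starts. -/
  | spolDone (M : Mem n K) (c : Call) (P : List (CPair n)) (F : List ℕ) :
      Step ord ⟨M, .spol c P [] F⟩ none ⟨M, .red c P F []⟩
  /-- The element `h` of smallest signature has normal form zero and is dropped. -/
  | redZero (M : Mem n K) (c : Call) (P : List (CPair n)) (todo done : List ℕ) (h : ℕ)
      (hh : h ∈ todo) (hmin : ∀ k ∈ todo, ¬ Sig.Lt ord (M.S k) (M.S h))
      (hq : IsNormalForm ord (M.polys c.prev) (M.poly h) 0) :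
      Step ord ⟨M, .red c P todo done⟩ none ⟨M.setPoly h 0, .red c P (todo.erase h) done⟩
  /-- The element `h` of smallest signature has no reductor: its normal form is made monic and `h`
  is moved to `done`. -/
  | redDone (M : Mem n K) (c : Call) (P : List (CPair n)) (todo done : List ℕ) (h : ℕ)
      (q : MvPolynomial (Fin n) K)
      (hh : h ∈ todo) (hmin : ∀ k ∈ todo, ¬ Sig.Lt ord (M.S k) (M.S h))
      (hq : IsNormalForm ord (M.polys c.prev) (M.poly h) q) (hq0 : q ≠ 0)
      (hirr : ∀ j, ¬ M.IsReductor ord c.prev (c.G ++ done) (M.S h) q j) :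
      Step ord ⟨M, .red c P todo done⟩ none
        ⟨M.setPoly h (MvPolynomial.C (ord.leadingCoeff q)⁻¹ * q),
          .red c P (todo.erase h) (done ++ [h])⟩
  /-- Signature-safe top-reduction of `h` by `r_j`; `h` stays in `todo`. -/
  | redSafe (M : Mem n K) (c : Call) (P : List (CPair n)) (todo done : List ℕ) (h j : ℕ)
      (q : MvPolynomial (Fin n) K)
      (hh : h ∈ todo) (hmin : ∀ k ∈ todo, ¬ Sig.Lt ord (M.S k) (M.S h))
      (hq : IsNormalForm ord (M.polys c.prev) (M.poly h) q) (hq0 : q ≠ 0)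
      (hj : M.IsReductor ord c.prev (c.G ++ done) (M.S h) q j)
      (hsafe : Sig.Lt ord ((M.S j).mul (ord.degree q - ord.degree (M.poly j))) (M.S h)) :
      Step ord ⟨M, .red c P todo done⟩ none
        ⟨M.setPoly h (q - MvPolynomial.monomial (ord.degree q - ord.degree (M.poly j))
            (ord.leadingCoeff q) * M.poly j),
          .red c P todo done⟩
  /-- The reduction of `h` by `r_j` is not signature-safe: a new S-polynomial is generated in which
  the multiple of `r_j` is the part of greater signature. -/
  | redNew (M : Mem n K) (c : Call) (P : List (CPair n)) (todo done : List ℕ) (h j : ℕ)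
      (q : MvPolynomial (Fin n) K)
      (hh : h ∈ todo) (hmin : ∀ k ∈ todo, ¬ Sig.Lt ord (M.S k) (M.S h))
      (hq : IsNormalForm ord (M.polys c.prev) (M.poly h) q) (hq0 : q ≠ 0)
      (hj : M.IsReductor ord c.prev (c.G ++ done) (M.S h) q j)
      (hnot : ¬ Sig.Lt ord ((M.S j).mul (ord.degree q - ord.degree (M.poly j))) (M.S h)) :
      Step ord ⟨M, .red c P todo done⟩
        (some ⟨M.N, ord.degree q - ord.degree (M.poly j), j, 0, h⟩)
        ⟨(M.setPoly h q).push ((M.S j).mul (ord.degree q - ord.degree (M.poly j)))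
            (MvPolynomial.monomial (ord.degree q - ord.degree (M.poly j)) 1 * M.poly j -
              MvPolynomial.C (ord.leadingCoeff q)⁻¹ * q),
          .red c P (todo ++ [M.N]) done⟩
  /-- `Reduction` returns; its result is added to `G` and the new critical pairs to `P`. -/
  | update (M : Mem n K) (c : Call) (P : List (CPair n)) (done : List ℕ) :
      Step ord ⟨M, .red c P [] done⟩ none
        ⟨M, .loop ⟨c.idx, c.prev, (M.addAll ord c.idx c.prev done c.G P).1⟩
          (M.addAll ord c.idx c.prev done c.G P).2⟩

/-- The initial state for the input `f 0, …, f (m - 1)`: the labeled polynomials `(F_k, f k)`, made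
monic, no rules, and all input polynomials still to be treated (from the last one to the first;
the first call, for `f (m - 1)`, creates no critical pairs). -/
noncomputable def initState {m : ℕ} (ord : MonomialOrder (Fin n))
    (f : Fin m → MvPolynomial (Fin n) K) : State n K where
  mem :=
    { N := m
      r := fun k => ⟨⟨0, k⟩,
        if hk : k < m then MvPolynomial.C (ord.leadingCoeff (f ⟨k, hk⟩))⁻¹ * f ⟨k, hk⟩ else 0⟩
      rule := fun _ => [] }
  phase := .outer m []

/-- A non-terminating execution of the algorithm on the input `f`: the sequence `s` of states and the
sequence `e` of records of generated S-polynomials. -/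
structure IsInfiniteExecution {m : ℕ} (ord : MonomialOrder (Fin n))
    (f : Fin m → MvPolynomial (Fin n) K) (s : ℕ → State n K) (e : ℕ → Option (Gen n)) : Prop where
  init : s 0 = initState ord f
  step : ∀ t, Step ord (s t) (e t) (s (t + 1))

/-- `g = x^u p - c x^v q` is the S-polynomial of `p` and `q`. -/
def IsSPolynomial (ord : MonomialOrder (Fin n)) (p q : MvPolynomial (Fin n) K)
    (u v : Fin n →₀ ℕ) (g : MvPolynomial (Fin n) K) : Prop :=
  p ≠ 0 ∧ q ≠ 0 ∧
  u + ord.degree p = ord.degree p ⊔ ord.degree q ∧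
  v + ord.degree q = ord.degree p ⊔ ord.degree q ∧
  g = MvPolynomial.monomial u 1 * p -
    MvPolynomial.monomial v (ord.leadingCoeff p / ord.leadingCoeff q) * q

/-- In the execution `(s, e)` the labeled polynomial `r_l` is generated as an S-polynomial whose part
of greater signature is a multiple of `r_k`. -/
def GeneratedFrom (ord : MonomialOrder (Fin n)) (s : ℕ → State n K) (e : ℕ → Option (Gen n))
    (l k : ℕ) : Prop :=
  ∃ (t : ℕ) (u v : Fin n →₀ ℕ) (j : ℕ),
    e t = some ⟨l, u, k, v, j⟩ ∧
    k < (s t).mem.N ∧ j < (s t).mem.N ∧ l = (s t).mem.N ∧ (s (t + 1)).mem.N = l + 1 ∧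
    (s (t + 1)).mem.S l = ((s (t + 1)).mem.S k).mul u ∧
    Sig.Lt ord (((s (t + 1)).mem.S j).mul v) ((s (t + 1)).mem.S l) ∧
    IsSPolynomial ord ((s (t + 1)).mem.poly k) ((s (t + 1)).mem.poly j) u v
      ((s (t + 1)).mem.poly l)

/-- The subsequence `r_{k 0}, r_{k 1}, …` of the sequence of generated labeled polynomials is an
infinite S-pair-chain: every term is generated as an S-polynomial whose part of greater signature
comes from the preceding term, and every signature divides the next one (at every moment at which
both terms exist). -/
structure IsInfiniteSPairChain (ord : MonomialOrder (Fin n)) (s : ℕ → State n K)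
    (e : ℕ → Option (Gen n)) (k : ℕ → ℕ) : Prop where
  strictMono : StrictMono k
  generated : ∀ a, GeneratedFrom ord s e (k (a + 1)) (k a)
  dvd : ∀ a t, k (a + 1) < (s t).mem.N → ((s t).mem.S (k a)).Dvd ((s t).mem.S (k (a + 1)))

end

end F5

namespace F5

section

variable {n : ℕ} {K : Type*} [Field K] {ord : MonomialOrder (Fin n)}

/-! The positions of the labeled polynomials form a forest: the roots are the input polynomials, and
the parent of a generated element is the element whose multiple is the part of greater signature. An
infinite S-pair-chain is an infinite branch of this forest, so König's lemma
(`exists_infinite_branch`) yields one once three facts are known.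

The forest is infinite (`exists_gen`, `exists_lt_N`): steps that generate nothing decrease a
well-founded measure (`Step.rank_lt`), so a non-terminating execution generates elements forever.
Every generated element has an earlier parent (`exists_generatedFrom`).

Every node has finitely many children (`finite_generatedFrom`): given infinitely many children of
`r_k` with multipliers `u_a`, Dickson's lemma gives an earlier child whose multiplier divides that
of a later one. The rule of the earlier child is newer than `r_k` and its signature divides that of
the later product, so that product was rewritten and should have been rejected.

An invariant (`State.Good`) supplies what these arguments need: rules match the signatures,
reductors and elements of `G` are monic, and only elements still being reduced are modified. -/

theorem Sig.Lt.asymm {S T : Sig n} (h : Sig.Lt ord S T) : ¬ Sig.Lt ord T S := by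
  rintro (h' | ⟨h₁, h₂⟩) <;> rcases h with h | ⟨h₃, h₄⟩
  · omega
  · omega
  · omega
  · exact lt_asymm h₂ h₄

theorem Sig.lt_of_not_lt_of_ne {S T : Sig n} (h : ¬ Sig.Lt ord S T) (hne : S ≠ T) :
    Sig.Lt ord T S := by
  simp only [Sig.Lt, not_or, not_and, not_lt] at h ⊢
  rcases h.1.lt_or_eq with h₁ | h₁
  · exact Or.inl h₁
  · refine Or.inr ⟨h₁.symm, lt_of_le_of_ne (h.2 h₁) fun he => hne ?_⟩
    exact Sig.ext (ord.toSyn.injective he).symm h₁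

/-! ### Normal forms and leading terms -/

theorem degree_le_of_isNormalForm {B : Set (MvPolynomial (Fin n) K)}
    {p q : MvPolynomial (Fin n) K} (h : IsNormalForm ord B p q) :
    ord.toSyn (ord.degree q) ≤ ord.toSyn (ord.degree p) := by
  obtain ⟨⟨g, hp, hdeg⟩, -⟩ := h
  have hq : q = p - Finsupp.linearCombination (MvPolynomial (Fin n) K)
      (fun b : B => (b : MvPolynomial (Fin n) K)) g := by
    rw [eq_sub_iff_add_eq, add_comm]; exact hp.symm
  rw [hq]
  refine ord.degree_sub_le.trans (sup_le le_rfl ?_)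
  rw [Finsupp.linearCombination_apply, Finsupp.sum]
  refine ord.degree_sum_le.trans (Finset.sup_le fun b _ => ?_)
  rw [smul_eq_mul, mul_comm]
  exact hdeg b

/-- Since the zero polynomial has degree `0`, the degree bound alone would still allow constant
terms `b * g b`. A nonzero one would make `b` a nonzero constant, whose leading monomial divides
every monomial of `q`. -/
theorem eq_zero_of_isNormalForm_zero {B : Set (MvPolynomial (Fin n) K)}
    {q : MvPolynomial (Fin n) K} (h : IsNormalForm ord B 0 q) : q = 0 := by
  obtain ⟨⟨g, hp, hdeg⟩, hirr⟩ := h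
  by_contra hq
  have hzero : ∀ b : B, (b : MvPolynomial (Fin n) K) * g b = 0 := by
    intro b
    by_contra hb
    have h0 : ord.degree ((b : MvPolynomial (Fin n) K) * g b) = 0 := by
      have := hdeg b
      rw [ord.degree_zero, map_zero] at this
      exact ord.toSyn.injective (le_antisymm this (bot_le.trans_eq' (by simp)) |>.trans (by simp))
    rw [ord.degree_mul' hb] at h0
    refine hirr _ (ord.degree_mem_support hq) b b.2 ?_
    rw [(add_eq_zero.mp h0).1]
    exact zero_le
  refine hq ?_
  rw [Finsupp.linearCombination_apply, Finsupp.sum, Finset.sum_eq_zero, zero_add] at hp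
  · exact hp.symm
  · intro b _
    rw [smul_eq_mul, mul_comm, hzero]

theorem monic_C_inv_leadingCoeff_mul {q : MvPolynomial (Fin n) K} (hq : q ≠ 0) :
    ord.Monic (MvPolynomial.C (ord.leadingCoeff q)⁻¹ * q) := by
  have hc : ord.leadingCoeff q ≠ 0 := ord.leadingCoeff_ne_zero_iff.mpr hq
  rw [MonomialOrder.Monic, ord.leadingCoeff_mul, ord.leadingCoeff_C,
    inv_mul_cancel₀ hc]

/-- Cancelling the leading term of a nonzero polynomial with a multiple of a monic polynomial
lowers the degree, where zero counts as the smallest polynomial. -/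
theorem withBotDegree_top_reduction_lt {p q : MvPolynomial (Fin n) K} (hp : ord.Monic p)
    (hq : q ≠ 0) (hle : ord.degree p ≤ ord.degree q) :
    ord.toWithBotSyn (ord.withBotDegree (q - MvPolynomial.monomial (ord.degree q - ord.degree p)
        (ord.leadingCoeff q) * p)) < ord.toWithBotSyn (ord.withBotDegree q) := by
  have hs : ord.sPolynomial q p = q - MvPolynomial.monomial (ord.degree q - ord.degree p)
        (ord.leadingCoeff q) * p := by
    rw [MonomialOrder.sPolynomial_def, sup_eq_left.mpr hle, tsub_self, hp.leadingCoeff_eq_one]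
    simp
  rw [← hs, ord.withBotDegree_lt_withBotDegree_iff]
  by_cases h0 : ord.sPolynomial q p = 0
  · simp [h0, hq]
  · have := ord.degree_sPolynomial_lt_sup_degree h0
    rw [sup_eq_left.mpr hle] at this
    simp [h0, hq, this]

/-! ### Rules and the rewritten criterion -/

/-- The consistency of the list of rules with the labeled polynomials. -/
structure Mem.WellFormed (ord : MonomialOrder (Fin n)) (m : ℕ) (M : Mem n K) : Prop where
  le : m ≤ M.N
  sig_input : ∀ k < m, M.S k = ⟨0, k⟩
  monic_input : ∀ k < m, ord.Monic (M.poly k)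
  rule_sorted : ∀ i, (M.rule i).Pairwise fun x y => y.2 < x.2
  rule_spec : ∀ i, ∀ x ∈ M.rule i, m ≤ x.2 ∧ x.2 < M.N ∧ M.S x.2 = ⟨x.1, i⟩
  rule_complete : ∀ k, m ≤ k → k < M.N → ((M.S k).mon, k) ∈ M.rule (M.S k).idx

/-- Rules are listed newest first, so the first match is at least as new as any other match. -/
theorem exists_find?_of_pairwise {α : Type*} {l : List (α × ℕ)}
    (hl : l.Pairwise fun x y => y.2 < x.2) {P : α × ℕ → Bool} {x : α × ℕ} (hx : x ∈ l)
    (hP : P x = true) : ∃ y, l.find? P = some y ∧ x.2 ≤ y.2 := by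
  induction l with
  | nil => simp at hx
  | cons a l ih =>
    rw [List.pairwise_cons] at hl
    by_cases ha : P a = true
    · refine ⟨a, by simp [ha], ?_⟩
      rcases List.mem_cons.mp hx with rfl | hx
      · exact le_rfl
      · exact (hl.1 x hx).le
    · rcases List.mem_cons.mp hx with rfl | hx
      · exact absurd hP ha
      · simpa [ha] using ih hl.2 hx

theorem Mem.WellFormed.rewritten {m : ℕ} {M : Mem n K} (hM : M.WellFormed ord m)
    {u : Fin n →₀ ℕ} {k l : ℕ} (hm : m ≤ l) (hl : l < M.N) (hkl : k < l)
    (hidx : (M.S l).idx = (M.S k).idx) (hle : (M.S l).mon ≤ u + (M.S k).mon) :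
    M.Rewritten u k := by
  have hmem := hM.rule_complete l hm hl
  rw [hidx] at hmem
  obtain ⟨y, hy, hly⟩ := exists_find?_of_pairwise (hM.rule_sorted _)
    (P := fun x => decide (x.1 ≤ u + (M.S k).mon)) hmem (by simpa using hle)
  have hr : M.rewrite u k = y.2 := by
    rw [Mem.rewrite, hy]
  rw [Mem.Rewritten, hr]
  dsimp only at hly
  omega

/-- The rule search depends only on the signature of the product. If it succeeds, both positions
equal the one found. If it fails, both elements are inputs, because the rule of a generated element
divides all its multiples; an input is determined by its index. This makes the two parts of an
S-polynomial from `Spol` differ strictly in signature. -/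
theorem Mem.WellFormed.eq_of_not_rewritten {m : ℕ} {M : Mem n K} (hM : M.WellFormed ord m)
    {u v : Fin n →₀ ℕ} {a b : ℕ} (ha : a < M.N) (hb : b < M.N) (hra : ¬ M.Rewritten u a)
    (hrb : ¬ M.Rewritten v b) (h : (M.S a).mul u = (M.S b).mul v) : a = b := by
  simp only [Mem.Rewritten, not_not] at hra hrb
  have hidx : (M.S a).idx = (M.S b).idx := (congrArg Sig.idx h :)
  have hmon : u + (M.S a).mon = v + (M.S b).mon := (congrArg Sig.mon h :)
  have hnone : ∀ {w : Fin n →₀ ℕ} {c : ℕ}, c < M.N →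
      (∀ x ∈ M.rule (M.S c).idx, ¬ x.1 ≤ w + (M.S c).mon) → (M.S c).idx = c := by
    intro w c hc hx
    rcases lt_or_ge c m with hcm | hcm
    · rw [hM.sig_input c hcm]
    · exact absurd le_add_self (hx _ (hM.rule_complete c hcm hc))
  unfold Mem.rewrite at hra hrb
  rw [hidx, hmon] at hra
  cases hf : (M.rule (M.S b).idx).find? (fun x => decide (x.1 ≤ v + (M.S b).mon)) with
  | some x =>
    rw [hf] at hra hrb
    exact hra.symm.trans hrb
  | none =>
    simp only [List.find?_eq_none, decide_eq_true_eq] at hf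
    rw [← hnone hb hf, ← hidx]
    refine (hnone (w := u) ha ?_).symm
    rwa [hidx, hmon]

@[simp] theorem Mem.push_N (M : Mem n K) (S : Sig n) (p : MvPolynomial (Fin n) K) :
    (M.push S p).N = M.N + 1 := rfl

@[simp] theorem Mem.setPoly_N (M : Mem n K) (h : ℕ) (p : MvPolynomial (Fin n) K) :
    (M.setPoly h p).N = M.N := rfl

@[simp] theorem Mem.setPoly_S (M : Mem n K) (h k : ℕ) (p : MvPolynomial (Fin n) K) :
    (M.setPoly h p).S k = M.S k := by
  by_cases hk : k = h
  · subst hk; simp [Mem.setPoly, Mem.S]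
  · simp [Mem.setPoly, Mem.S, hk]

theorem Mem.setPoly_r {M : Mem n K} {h k : ℕ} {p : MvPolynomial (Fin n) K} (hk : k ≠ h) :
    (M.setPoly h p).r k = M.r k := by simp [Mem.setPoly, hk]

theorem Mem.setPoly_poly_self (M : Mem n K) (h : ℕ) (p : MvPolynomial (Fin n) K) :
    (M.setPoly h p).poly h = p := by simp [Mem.setPoly, Mem.poly]

theorem Mem.push_r {M : Mem n K} {S : Sig n} {p : MvPolynomial (Fin n) K} {k : ℕ}
    (hk : k < M.N) : (M.push S p).r k = M.r k := by simp [Mem.push, hk.ne]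

theorem Mem.push_r_self (M : Mem n K) (S : Sig n) (p : MvPolynomial (Fin n) K) :
    (M.push S p).r M.N = ⟨S, p⟩ := by simp [Mem.push]

theorem Mem.WellFormed.setPoly {m : ℕ} {M : Mem n K} (hM : M.WellFormed ord m) {h : ℕ}
    (hh : m ≤ h) (p : MvPolynomial (Fin n) K) : (M.setPoly h p).WellFormed ord m where
  le := hM.le
  sig_input k hk := by rw [Mem.setPoly_S]; exact hM.sig_input k hk
  monic_input k hk := by
    rw [Mem.poly, Mem.setPoly_r (by omega)]; exact hM.monic_input k hk
  rule_sorted := hM.rule_sorted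
  rule_spec i x hx := by rw [Mem.setPoly_S]; exact hM.rule_spec i x hx
  rule_complete k hk hN := by rw [Mem.setPoly_S]; exact hM.rule_complete k hk hN

theorem Mem.WellFormed.push {m : ℕ} {M : Mem n K} (hM : M.WellFormed ord m) (S : Sig n)
    (p : MvPolynomial (Fin n) K) : (M.push S p).WellFormed ord m where
  le := hM.le.trans (Nat.le_succ _)
  sig_input k hk := by
    rw [Mem.S, Mem.push_r (hk.trans_le hM.le)]; exact hM.sig_input k hk
  monic_input k hk := by
    rw [Mem.poly, Mem.push_r (hk.trans_le hM.le)]; exact hM.monic_input k hk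
  rule_sorted i := by
    by_cases hi : i = S.idx
    · subst hi
      simp only [Mem.push, Function.update_self, List.pairwise_cons]
      exact ⟨fun x hx => (hM.rule_spec _ x hx).2.1, hM.rule_sorted _⟩
    · simpa [Mem.push, hi] using hM.rule_sorted i
  rule_spec i x hx := by
    have key : x ∈ M.rule i → m ≤ x.2 ∧ x.2 < (M.push S p).N ∧ (M.push S p).S x.2 = ⟨x.1, i⟩ := by
      intro hx
      obtain ⟨h₁, h₂, h₃⟩ := hM.rule_spec i x hx
      refine ⟨h₁, h₂.trans (Nat.lt_succ_self _), ?_⟩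
      rw [Mem.S, Mem.push_r h₂]; exact h₃
    by_cases hi : i = S.idx
    · subst hi
      simp only [Mem.push, Function.update_self, List.mem_cons] at hx
      rcases hx with rfl | hx
      · refine ⟨hM.le, Nat.lt_succ_self _, ?_⟩
        rw [Mem.S, Mem.push_r_self]
      · exact key hx
    · refine key ?_
      simpa [Mem.push, hi] using hx
  rule_complete k hk hN := by
    rcases (Nat.lt_succ_iff_lt_or_eq.mp hN : k < M.N ∨ k = M.N) with h | rfl
    · rw [Mem.S, Mem.push_r h]
      have := hM.rule_complete k hk h
      by_cases hi : (M.r k).sig.idx = S.idx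
      · rw [Mem.S, hi] at this
        simp only [Mem.push, hi, Function.update_self, List.mem_cons]
        exact Or.inr this
      · simpa [Mem.push, Mem.S, hi] using this
    · rw [Mem.S, Mem.push_r_self]
      simp [Mem.push]

/-! ### The invariant of the algorithm -/

/-- The elements of `G` are monic and their positions are at least `i`. -/
def Mem.GoodList (ord : MonomialOrder (Fin n)) (M : Mem n K) (i : ℕ) (G : List ℕ) : Prop :=
  ∀ j ∈ G, i ≤ j ∧ j < M.N ∧ ord.Monic (M.poly j)

/-- The critical pair `p` is a correctly oriented pair of two different elements of `G`. -/
structure Mem.GoodPair (ord : MonomialOrder (Fin n)) (M : Mem n K) (G : List ℕ) (p : CPair n) :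
    Prop where
  hi_mem : p.hi ∈ G
  lo_mem : p.lo ∈ G
  ne : p.hi ≠ p.lo
  hi_deg : p.u + ord.degree (M.poly p.hi) =
    ord.degree (M.poly p.hi) ⊔ ord.degree (M.poly p.lo)
  lo_deg : p.v + ord.degree (M.poly p.lo) =
    ord.degree (M.poly p.hi) ⊔ ord.degree (M.poly p.lo)
  not_lt : ¬ Sig.Lt ord ((M.S p.hi).mul p.u) ((M.S p.lo).mul p.v)

/-- The elements under reduction are pairwise different, and they are neither input polynomials nor
elements of `G`. -/
structure Mem.GoodWork (M : Mem n K) (m : ℕ) (G L : List ℕ) : Prop where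
  nodup : L.Nodup
  le : ∀ k ∈ L, m ≤ k
  lt : ∀ k ∈ L, k < M.N
  notMem : ∀ k ∈ L, k ∉ G

theorem Mem.GoodList.congr {M M' : Mem n K} {i : ℕ} {G : List ℕ} (h : M.GoodList ord i G)
    (hN : M.N ≤ M'.N) (hr : ∀ j ∈ G, M'.r j = M.r j) : M'.GoodList ord i G := by
  intro j hj
  obtain ⟨h₁, h₂, h₃⟩ := h j hj
  refine ⟨h₁, h₂.trans_le hN, ?_⟩
  rwa [Mem.poly, hr j hj]

/-- A pair stores multipliers computed when it was formed; they stay correct because elements of `G`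
are never modified again. -/
theorem Mem.GoodPair.congr {M M' : Mem n K} {G : List ℕ} {p : CPair n}
    (h : M.GoodPair ord G p) (hr : ∀ j ∈ G, M'.r j = M.r j) : M'.GoodPair ord G p := by
  obtain ⟨h₁, h₂, h₃, h₄, h₅, h₆⟩ := h
  unfold Mem.S at h₆
  unfold Mem.poly at h₄ h₅
  rw [← hr _ h₁, ← hr _ h₂] at h₄ h₅ h₆
  exact ⟨h₁, h₂, h₃, h₄, h₅, h₆⟩

theorem Mem.GoodPair.mono {M : Mem n K} {G G' : List ℕ} {p : CPair n}
    (h : M.GoodPair ord G p) (hG : G ⊆ G') : M.GoodPair ord G' p :=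
  ⟨hG h.hi_mem, hG h.lo_mem, h.ne, h.hi_deg, h.lo_deg, h.not_lt⟩

theorem Mem.goodPair_of_critPair {M : Mem n K} {i : ℕ} {prev G : List ℕ} {a b : ℕ}
    (ha : a ∈ G) (hb : b ∈ G) (hab : a ≠ b) {p : CPair n}
    (h : M.critPair ord i prev a b = some p) : M.GoodPair ord G p := by
  have hp : p = M.orientedPair ord a b := by
    unfold Mem.critPair at h
    dsimp only at h
    split_ifs at h
    exact (Option.some.inj h).symm
  subst hp
  unfold Mem.orientedPair
  dsimp only
  split_ifs with hlt
  · exact ⟨hb, ha, hab.symm, by rw [sup_comm]; exact tsub_add_cancel_of_le le_sup_left,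
      by rw [sup_comm]; exact tsub_add_cancel_of_le le_sup_right, hlt.asymm⟩
  · exact ⟨ha, hb, hab, tsub_add_cancel_of_le le_sup_left, tsub_add_cancel_of_le le_sup_right,
      hlt⟩

theorem Mem.addAll_fst (M : Mem n K) (i : ℕ) (prev : List ℕ) (L G : List ℕ)
    (P : List (CPair n)) : (M.addAll ord i prev L G P).1 = G ++ L := by
  induction L generalizing G P with
  | nil => simp [Mem.addAll]
  | cons a L ih => simp [Mem.addAll, ih]

theorem Mem.goodPair_addAll {M : Mem n K} {i : ℕ} {prev L G : List ℕ} {P : List (CPair n)}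
    (hnd : L.Nodup) (hdisj : ∀ k ∈ L, k ∉ G) (hP : ∀ p ∈ P, M.GoodPair ord G p) :
    ∀ p ∈ (M.addAll ord i prev L G P).2, M.GoodPair ord (G ++ L) p := by
  induction L generalizing G P with
  | nil => simpa [Mem.addAll] using hP
  | cons a L ih =>
    rw [List.nodup_cons] at hnd
    have := ih (G := G ++ [a]) (P := P ++ G.filterMap (M.critPair ord i prev a)) hnd.2 ?_ ?_
    · simpa [Mem.addAll] using this
    · intro k hk hk'
      rcases List.mem_append.mp hk' with h | h
      · exact hdisj k (List.mem_cons_of_mem _ hk) h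
      · rw [List.mem_singleton] at h
        exact hnd.1 (h ▸ hk)
    · intro p hp
      rcases List.mem_append.mp hp with h | h
      · exact (hP p h).mono (List.subset_append_left _ _)
      · obtain ⟨b, hb, hpb⟩ := List.mem_filterMap.mp h
        refine Mem.goodPair_of_critPair (by simp) (List.mem_append_left _ hb) ?_ hpb
        rintro rfl
        exact hdisj a List.mem_cons_self hb

/-- The invariant of the algorithm on `m` input polynomials at its control points. -/
def Phase.Good (ord : MonomialOrder (Fin n)) (m : ℕ) (M : Mem n K) : Phase n → Prop
  | .outer i G => i ≤ m ∧ M.GoodList ord i G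
  | .loop c P => c.idx ≤ m ∧ M.GoodList ord c.idx c.G ∧ ∀ p ∈ P, M.GoodPair ord c.G p
  | .spol c P Q F => c.idx ≤ m ∧ M.GoodList ord c.idx c.G ∧
      (∀ p ∈ P, M.GoodPair ord c.G p) ∧ (∀ p ∈ Q, M.GoodPair ord c.G p) ∧ M.GoodWork m c.G F
  | .red c P todo done => c.idx ≤ m ∧ M.GoodList ord c.idx c.G ∧
      (∀ p ∈ P, M.GoodPair ord c.G p) ∧ M.GoodWork m c.G (todo ++ done) ∧
      ∀ k ∈ done, ord.Monic (M.poly k)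
  | .halt _ => True

/-- The invariant of the algorithm on `m` input polynomials. -/
structure State.Good (ord : MonomialOrder (Fin n)) (m : ℕ) (st : State n K) : Prop where
  mem : st.mem.WellFormed ord m
  phase : st.phase.Good ord m st.mem

theorem Mem.GoodWork.ne_of_mem {M : Mem n K} {m : ℕ} {G L : List ℕ}
    (hw : M.GoodWork m G L) {h j : ℕ} (hh : h ∈ L) (hj : j ∈ G) : j ≠ h := by
  rintro rfl
  exact hw.notMem _ hh hj

theorem Mem.GoodWork.push {M : Mem n K} {m i : ℕ} {G L L' : List ℕ} (hw : M.GoodWork m G L)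
    (hm : m ≤ M.N) (hG : M.GoodList ord i G) (hL : L'.Perm (M.N :: L)) (S : Sig n)
    (p : MvPolynomial (Fin n) K) :
    (M.push S p).GoodWork m G L' := by
  refine ⟨hL.nodup_iff.mpr (List.nodup_cons.mpr ⟨fun h => (hw.lt _ h).false, hw.nodup⟩), ?_, ?_, ?_⟩
  · intro k hk
    rcases List.mem_cons.mp (hL.mem_iff.mp hk) with rfl | hk
    · exact hm
    · exact hw.le k hk
  · intro k hk
    rcases List.mem_cons.mp (hL.mem_iff.mp hk) with rfl | hk
    · exact Nat.lt_succ_self _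
    · exact (hw.lt k hk).trans (Nat.lt_succ_self _)
  · intro k hk
    rcases List.mem_cons.mp (hL.mem_iff.mp hk) with rfl | hk
    · exact fun h => (hG _ h).2.1.false
    · exact hw.notMem k hk

theorem Mem.GoodWork.sublist {M M' : Mem n K} {m : ℕ} {G L L' : List ℕ} (hw : M.GoodWork m G L)
    (hN : M.N ≤ M'.N) (hnd : L'.Nodup) (hL : L' ⊆ L) : M'.GoodWork m G L' :=
  ⟨hnd, fun k hk => hw.le k (hL hk), fun k hk => (hw.lt k (hL hk)).trans_le hN,
    fun k hk => hw.notMem k (hL hk)⟩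

theorem State.Good.init {m : ℕ} {f : Fin m → MvPolynomial (Fin n) K} (hf : ∀ i, f i ≠ 0) :
    (initState ord f).Good ord m where
  mem :=
    { le := le_rfl
      sig_input := fun k _ => rfl
      monic_input := fun k hk => by
        simpa [initState, Mem.poly, hk] using monic_C_inv_leadingCoeff_mul (hf ⟨k, hk⟩)
      rule_sorted := fun i => List.Pairwise.nil
      rule_spec := fun i x hx => by simp [initState] at hx
      rule_complete := fun k h₁ h₂ => absurd h₂ (not_lt.mpr h₁) }
  phase := ⟨le_rfl, by simp [Mem.GoodList]⟩

/-- The only polynomial part ever overwritten belongs to an element of `todo`, which is disjoint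
from the inputs, from `G` and from `done`; everything asserted about those therefore persists. -/
theorem State.Good.of_step {m : ℕ} {st st' : State n K} {g : Option (Gen n)}
    (hst : st.Good ord m) (h : Step ord st g st') : st'.Good ord m := by
  obtain ⟨hM, hP⟩ := hst
  cases h with
  | call M i G =>
    obtain ⟨hi, hG⟩ := hP
    -- Inputs are treated in decreasing order, so all positions in `G` are at least `i + 1`.
    have hiG : i ∉ G := fun h => by have := (hG i h).1; omega
    refine ⟨hM, (Nat.le_succ i).trans hi, ?_, ?_⟩
    · intro j hj
      rcases List.mem_append.mp hj with h | h
      · exact ⟨(Nat.le_succ i).trans (hG j h).1, (hG j h).2⟩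
      · rw [List.mem_singleton] at h
        subst h
        exact ⟨le_rfl, (Nat.lt_of_succ_le hi).trans_le hM.le, hM.monic_input _ hi⟩
    · intro p hp
      obtain ⟨b, hb, hpb⟩ := List.mem_filterMap.mp hp
      refine Mem.goodPair_of_critPair (by simp) (List.mem_append_left _ hb) ?_ hpb
      rintro rfl
      exact hiG hb
  | finish M G => exact ⟨hM, trivial⟩
  | unit M i G j hj h1 => exact ⟨hM, trivial⟩
  | ret M c => exact ⟨hM, hP.1, hP.2.1⟩
  | select M c P Q d hd hmin hQ =>
    obtain ⟨hi, hG, hP⟩ := hP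
    refine ⟨hM, hi, hG, fun p hp => hP p (List.mem_of_mem_filter hp),
      fun p hp => hP p (List.mem_of_mem_filter (hQ.mem_iff.mp hp)), ?_⟩
    exact ⟨List.nodup_nil, by simp, by simp, by simp⟩
  | spolSkip M c P Q F p h =>
    obtain ⟨hi, hG, hP, hQ, hF⟩ := hP
    exact ⟨hM, hi, hG, hP, fun p hp => hQ p (List.mem_cons_of_mem _ hp), hF⟩
  | spolNew M c P Q F p h₁ h₂ =>
    obtain ⟨hi, hG, hP, hQ, hF⟩ := hP
    have hr : ∀ S q, ∀ j ∈ c.G, (M.push S q).r j = M.r j := fun S q j hj =>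
      Mem.push_r (hG j hj).2.1
    exact ⟨hM.push _ _, hi, hG.congr (Nat.le_succ _) (hr _ _),
      fun p hp => (hP p hp).congr (hr _ _),
      fun p hp => (hQ p (List.mem_cons_of_mem _ hp)).congr (hr _ _),
      hF.push hM.le hG (List.perm_append_singleton _ _) _ _⟩
  | spolDone M c P F =>
    obtain ⟨hi, hG, hP, -, hF⟩ := hP
    exact ⟨hM, hi, hG, hP, by simpa using hF, by simp⟩
  | redZero M c P todo done h hh hmin hq =>
    obtain ⟨hi, hG, hP, hw, hd⟩ := hP
    have hr : ∀ q, ∀ j ∈ c.G, (M.setPoly h q).r j = M.r j := fun q j hj =>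
      Mem.setPoly_r (hw.ne_of_mem (List.mem_append_left _ hh) hj)
    refine ⟨hM.setPoly (hw.le h (List.mem_append_left _ hh)) _, hi, hG.congr le_rfl (hr _),
      fun p hp => (hP p hp).congr (hr _), ?_, ?_⟩
    · have hsub : (todo.erase h ++ done).Sublist (todo ++ done) :=
        (List.erase_sublist).append_right _
      exact hw.sublist le_rfl (hw.nodup.sublist hsub) hsub.subset
    · intro k hk
      have hkh : k ≠ h := fun e => List.disjoint_of_nodup_append hw.nodup hh (e ▸ hk)
      rw [Mem.poly, Mem.setPoly_r hkh]
      exact hd k hk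
  | redDone M c P todo done h q hh hmin hq hq0 hirr =>
    obtain ⟨hi, hG, hP, hw, hd⟩ := hP
    have hr : ∀ q, ∀ j ∈ c.G, (M.setPoly h q).r j = M.r j := fun q j hj =>
      Mem.setPoly_r (hw.ne_of_mem (List.mem_append_left _ hh) hj)
    refine ⟨hM.setPoly (hw.le h (List.mem_append_left _ hh)) _, hi, hG.congr le_rfl (hr _),
      fun p hp => (hP p hp).congr (hr _), ?_, ?_⟩
    · have hperm : (todo.erase h ++ (done ++ [h])).Perm (todo ++ done) := by
        refine List.Perm.trans ?_ ((List.perm_cons_erase hh).symm.append_right _)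
        rw [← List.append_assoc]
        exact List.perm_append_singleton _ _
      exact hw.sublist le_rfl (hperm.nodup_iff.mpr hw.nodup) hperm.subset
    · intro k hk
      by_cases hkh : k = h
      · subst hkh
        rw [Mem.setPoly_poly_self]
        exact monic_C_inv_leadingCoeff_mul hq0
      · rw [Mem.poly, Mem.setPoly_r hkh]
        exact hd k (by simpa [hkh] using hk)
  | redSafe M c P todo done h j q hh hmin hq hq0 hj hsafe =>
    obtain ⟨hi, hG, hP, hw, hd⟩ := hP
    have hr : ∀ q, ∀ j ∈ c.G, (M.setPoly h q).r j = M.r j := fun q j hj =>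
      Mem.setPoly_r (hw.ne_of_mem (List.mem_append_left _ hh) hj)
    refine ⟨hM.setPoly (hw.le h (List.mem_append_left _ hh)) _, hi, hG.congr le_rfl (hr _),
      fun p hp => (hP p hp).congr (hr _),
      hw.sublist le_rfl hw.nodup (List.Subset.refl _), ?_⟩
    intro k hk
    have hkh : k ≠ h := fun e => List.disjoint_of_nodup_append hw.nodup hh (e ▸ hk)
    rw [Mem.poly, Mem.setPoly_r hkh]
    exact hd k hk
  | redNew M c P todo done h j q hh hmin hq hq0 hj hnot =>
    obtain ⟨hi, hG, hP, hw, hd⟩ := hP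
    have hr : ∀ q S p, ∀ j ∈ c.G, ((M.setPoly h q).push S p).r j = M.r j := fun q S p j hj =>
      (Mem.push_r (M := M.setPoly h q) (hG j hj).2.1).trans
        (Mem.setPoly_r (hw.ne_of_mem (List.mem_append_left _ hh) hj))
    have hG' : (M.setPoly h q).GoodList ord c.idx c.G := hG.congr le_rfl fun j hj =>
      Mem.setPoly_r (hw.ne_of_mem (List.mem_append_left _ hh) hj)
    refine ⟨(hM.setPoly (hw.le h (List.mem_append_left _ hh)) _).push _ _, hi,
      hG.congr (Nat.le_succ _) (hr _ _ _), fun p hp => (hP p hp).congr (hr _ _ _), ?_, ?_⟩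
    · refine (hw.sublist le_rfl hw.nodup (List.Subset.refl _) :
        (M.setPoly h q).GoodWork m c.G (todo ++ done)).push hM.le hG' ?_ _ _
      rw [List.append_assoc]
      exact List.perm_middle
    · intro k hk
      have hkh : k ≠ h := fun e => List.disjoint_of_nodup_append hw.nodup hh (e ▸ hk)
      rw [Mem.poly, Mem.push_r (M := M.setPoly h q) (hw.lt k (List.mem_append_right _ hk)),
        Mem.setPoly_r hkh]
      exact hd k hk
  | update M c P done =>
    obtain ⟨hi, hG, hP, hw, hd⟩ := hP
    rw [List.nil_append] at hw
    refine ⟨hM, hi, ?_, ?_⟩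
    · rw [Mem.addAll_fst]
      intro j hj
      rcases List.mem_append.mp hj with h | h
      · exact hG j h
      · exact ⟨hi.trans (hw.le j h), hw.lt j h, hd j h⟩
    · rw [Mem.addAll_fst]
      exact Mem.goodPair_addAll hw.nodup hw.notMem hP

/-! ### Effect of a single step and the generated S-polynomials -/

theorem Step.N_le {st st' : State n K} {g : Option (Gen n)} (h : Step ord st g st') :
    st.mem.N ≤ st'.mem.N := by
  cases h <;> simp

theorem Step.N_eq {st st' : State n K} (h : Step ord st none st') :
    st'.mem.N = st.mem.N := by
  cases h <;> simp

theorem Step.S_eq {st st' : State n K} {g : Option (Gen n)} (h : Step ord st g st') {k : ℕ}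
    (hk : k < st.mem.N) : st'.mem.S k = st.mem.S k := by
  cases h with
  | spolNew => rw [Mem.S, Mem.push_r hk]; rfl
  | redNew M c P todo done h j q =>
    rw [Mem.S, Mem.push_r (by exact hk)]; exact Mem.setPoly_S M h k q
  | _ => simp

theorem isSPolynomial_of_monic {p q : MvPolynomial (Fin n) K} {u v : Fin n →₀ ℕ}
    (hp : ord.Monic p) (hq : q ≠ 0) (hu : u + ord.degree p = ord.degree p ⊔ ord.degree q)
    (hv : v + ord.degree q = ord.degree p ⊔ ord.degree q) :
    IsSPolynomial ord p q u v (MvPolynomial.monomial u 1 * p -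
      MvPolynomial.monomial v (ord.leadingCoeff q)⁻¹ * q) :=
  ⟨hp.ne_zero, hq, hu, hv, by rw [hp.leadingCoeff_eq_one, one_div]⟩

/-- What an S-polynomial recorded as `g` has in common when it is generated by `Spol` or by
`TopReduction`. -/
theorem Step.gen {m : ℕ} {st st' : State n K} {g : Gen n} (hst : st.Good ord m)
    (h : Step ord st (some g) st') :
    g.new = st.mem.N ∧ st'.mem.N = st.mem.N + 1 ∧ g.hi < st.mem.N ∧ g.lo < st.mem.N ∧
    ¬ st.mem.Rewritten g.u g.hi ∧
    st'.mem.S g.new = (st'.mem.S g.hi).mul g.u ∧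
    Sig.Lt ord ((st'.mem.S g.lo).mul g.v) (st'.mem.S g.new) ∧
    IsSPolynomial ord (st'.mem.poly g.hi) (st'.mem.poly g.lo) g.u g.v (st'.mem.poly g.new) := by
  obtain ⟨hM, hP⟩ := hst
  generalize hog : some g = og at h
  cases h with
  | spolNew M c P Q F p h₁ h₂ =>
    obtain rfl := Option.some.inj hog
    obtain ⟨hi, hG, hP, hQ, hF⟩ := hP
    have hp := hQ p List.mem_cons_self
    obtain ⟨-, hhi, hmhi⟩ := hG _ hp.hi_mem
    obtain ⟨-, hlo, hmlo⟩ := hG _ hp.lo_mem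
    refine ⟨rfl, rfl, hhi, hlo, h₁, ?_, ?_, ?_⟩
    · simp only [Mem.S, Mem.push_r hhi, Mem.push_r_self]
    · simp only [Mem.S, Mem.push_r hlo, Mem.push_r_self]
      exact Sig.lt_of_not_lt_of_ne hp.not_lt fun he =>
        hp.ne (hM.eq_of_not_rewritten hhi hlo h₁ h₂ he)
    · simp only [Mem.poly, Mem.push_r hhi, Mem.push_r hlo, Mem.push_r_self]
      have := isSPolynomial_of_monic hmhi hmlo.ne_zero hp.hi_deg hp.lo_deg
      rwa [hmlo.leadingCoeff_eq_one, inv_one] at this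
  | redNew M c P todo done h j q hh hmin hq hq0 hj hnot =>
    obtain rfl := Option.some.inj hog
    obtain ⟨hi, hG, hP, hw, hd⟩ := hP
    obtain ⟨hjL, hdeg, -, hrw, hne⟩ := hj
    have hhN : h < M.N := hw.lt h (List.mem_append_left _ hh)
    have hjs : j < M.N ∧ ord.Monic (M.poly j) ∧ j ≠ h := by
      rcases List.mem_append.mp hjL with hj | hj
      · exact ⟨(hG j hj).2.1, (hG j hj).2.2, hw.ne_of_mem (List.mem_append_left _ hh) hj⟩
      · exact ⟨hw.lt j (List.mem_append_right _ hj), hd j hj,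
          fun e => List.disjoint_of_nodup_append hw.nodup hh (e ▸ hj)⟩
    obtain ⟨hjN, hjm, hjh⟩ := hjs
    have hr : ∀ S p, ((M.setPoly h q).push S p).r j = M.r j := fun S p =>
      (Mem.push_r (by exact hjN)).trans (Mem.setPoly_r hjh)
    -- The S-polynomial is formed with the normal form `q`, now stored at `h`. Its leading monomial
    -- is already the least common multiple, hence the multiplier exponent `0`.
    have hr' : ∀ S p, ((M.setPoly h q).push S p).r h = ⟨M.S h, q⟩ := fun S p =>
      (Mem.push_r (by exact hhN)).trans (by simp [Mem.setPoly])
    have hself : ∀ S p, ((M.setPoly h q).push S p).r M.N = ⟨S, p⟩ := fun S p =>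
      Mem.push_r_self _ _ _
    refine ⟨rfl, rfl, hjN, hhN, hrw, ?_, ?_, ?_⟩
    · simp only [Mem.S, hr, hself]
    · simp only [Mem.S, hr', hself]
      have : (M.r h).sig.mul 0 = M.S h := by simp [Sig.mul, Mem.S]
      rw [this]
      exact Sig.lt_of_not_lt_of_ne hnot hne
    · simp only [Mem.poly, hr, hr', hself]
      exact isSPolynomial_of_monic hjm hq0
        ((tsub_add_cancel_of_le hdeg).trans (sup_eq_right.mpr hdeg).symm)
        (by rw [zero_add]; exact (sup_eq_right.mpr hdeg).symm)
  | _ => cases hog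

/-! ### The termination measure -/

/-- The components of the termination measure that depend on the control point only: the progress of
the outer loop, whether there are elements under construction, the number of pairs still to be
treated, and the number of elements to be reduced. -/
def Phase.rank : Phase n → ℕ × ℕ × ℕ × ℕ
  | .outer i _ => (2 * i + 1, 0, 0, 0)
  | .loop c P => (2 * c.idx + 2, 0, 4 * P.length, 0)
  | .spol c P Q F => (2 * c.idx + 2, min 1 F.length, 4 * P.length + Q.length + 2, 0)
  | .red c P todo done =>
      (2 * c.idx + 2, min 1 (todo.length + done.length), 4 * P.length + 1, todo.length)
  | .halt _ => (0, 0, 0, 0)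

/-- The leading monomials of the first `N` labeled polynomials. -/
noncomputable def Mem.leads (ord : MonomialOrder (Fin n)) (N : ℕ) (M : Mem n K) :
    Fin N → WithBot ord.syn :=
  fun k => ord.toWithBotSyn (ord.withBotDegree (M.poly k))

/-- A measure that is decreased by every step that does not generate an S-polynomial. -/
noncomputable def State.rank (ord : MonomialOrder (Fin n)) (N : ℕ) (st : State n K) :
    ℕ ×ₗ ℕ ×ₗ ℕ ×ₗ ℕ ×ₗ (Fin N → WithBot ord.syn) :=
  toLex (st.phase.rank.1, toLex (st.phase.rank.2.1, toLex (st.phase.rank.2.2.1,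
    toLex (st.phase.rank.2.2.2, st.mem.leads ord N))))

theorem State.rank_lt_of_phase {N : ℕ} {st st' : State n K}
    (h : st'.phase.rank.1 < st.phase.rank.1 ∨ st'.phase.rank.1 = st.phase.rank.1 ∧
      (st'.phase.rank.2.1 < st.phase.rank.2.1 ∨ st'.phase.rank.2.1 = st.phase.rank.2.1 ∧
      (st'.phase.rank.2.2.1 < st.phase.rank.2.2.1 ∨
        st'.phase.rank.2.2.1 = st.phase.rank.2.2.1 ∧
      st'.phase.rank.2.2.2 < st.phase.rank.2.2.2))) :
    st'.rank ord N < st.rank ord N := by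
  simp only [State.rank, Prod.Lex.toLex_lt_toLex]
  tauto

theorem State.rank_lt_of_leads {N : ℕ} {st st' : State n K}
    (h : st'.phase.rank = st.phase.rank) (h' : st'.mem.leads ord N < st.mem.leads ord N) :
    st'.rank ord N < st.rank ord N := by
  simp only [State.rank, Prod.Lex.toLex_lt_toLex, h, true_and]
  exact Or.inr (Or.inr (Or.inr (Or.inr h')))

theorem Mem.leads_setPoly_lt {M : Mem n K} {h : ℕ} {p : MvPolynomial (Fin n) K}
    (hh : h < M.N) (hp : ord.toWithBotSyn (ord.withBotDegree p) <
      ord.toWithBotSyn (ord.withBotDegree (M.poly h))) :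
    (M.setPoly h p).leads ord M.N < M.leads ord M.N := by
  rw [Pi.lt_def]
  refine ⟨fun k => ?_, ⟨h, hh⟩, ?_⟩
  · by_cases hk : (k : ℕ) = h
    · simpa [Mem.leads, hk, Mem.setPoly_poly_self] using hp.le
    · simp [Mem.leads, Mem.poly, Mem.setPoly_r hk]
  · simpa [Mem.leads, Mem.setPoly_poly_self] using hp

theorem Step.rank_lt {m : ℕ} {st st' : State n K} (hst : st.Good ord m)
    (h : Step ord st none st') : st'.rank ord st.mem.N < st.rank ord st.mem.N := by
  obtain ⟨hM, hP⟩ := hst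
  generalize hog : none = og at h
  cases h with
  | call M i G =>
    refine State.rank_lt_of_phase ?_
    simp only [Phase.rank, true_and]
    omega
  | finish M G =>
    refine State.rank_lt_of_phase ?_
    simp only [Phase.rank, true_and]
    omega
  | unit M i G j hj h1 =>
    refine State.rank_lt_of_phase ?_
    simp only [Phase.rank, true_and]
    omega
  | ret M c =>
    refine State.rank_lt_of_phase ?_
    simp only [Phase.rank, true_and]
    omega
  | select M c P Q d hd hmin hQ =>
    obtain ⟨p, hp, hpd⟩ := hd
    have hlen : P.length = Q.length + (P.filter (fun p => decide (p.t.degree ≠ d))).length := by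
      rw [hQ.length_eq, List.length_eq_length_filter_add (fun p => decide (p.t.degree = d))]
      simp
    -- At least one pair is selected; the weight `4` per waiting pair then pays for `Q.length + 2`.
    have hpos : 0 < Q.length := List.length_pos_of_mem (hQ.mem_iff.mpr (by simpa using ⟨hp, hpd⟩))
    refine State.rank_lt_of_phase ?_
    simp only [Phase.rank, true_and, List.length_nil]
    omega
  | spolSkip M c P Q F p h =>
    refine State.rank_lt_of_phase ?_
    simp only [Phase.rank, true_and, List.length_cons]
    omega
  | spolDone M c P F =>
    refine State.rank_lt_of_phase ?_
    simp only [Phase.rank, true_and, List.length_nil]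
    omega
  | redZero M c P todo done h hh hmin hq =>
    have := List.length_erase_of_mem hh
    have := List.length_pos_of_mem hh
    refine State.rank_lt_of_phase ?_
    simp only [Phase.rank, true_and]
    omega
  | redDone M c P todo done h q hh hmin hq hq0 hirr =>
    have := List.length_erase_of_mem hh
    have := List.length_pos_of_mem hh
    refine State.rank_lt_of_phase ?_
    simp only [Phase.rank, true_and, List.length_append, List.length_singleton]
    omega
  | redSafe M c P todo done h j q hh hmin hq hq0 hj hsafe =>
    obtain ⟨hi, hG, hP, hw, hd⟩ := hP
    have hjm : ord.Monic (M.poly j) := by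
      rcases List.mem_append.mp hj.1 with hj | hj
      · exact (hG j hj).2.2
      · exact hd j hj
    refine State.rank_lt_of_leads rfl (Mem.leads_setPoly_lt (hw.lt h (List.mem_append_left _ hh))
      ((withBotDegree_top_reduction_lt hjm hq0 hj.2.1).trans_le ?_))
    -- Excludes replacing the smallest value `⊥` by the degree of a nonzero normal form.
    have hp0 : M.poly h ≠ 0 := fun h0 => hq0 (eq_zero_of_isNormalForm_zero (h0 ▸ hq))
    exact (ord.withBotDegree_le_withBotDegree_iff_of_ne_zero _ hp0).mpr
      (degree_le_of_isNormalForm hq)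
  | update M c P done =>
    refine State.rank_lt_of_phase ?_
    -- With `done` empty no pair is added and the third component drops by one. Otherwise many pairs
    -- may be added, but the second component falls from `1` to `0`.
    cases done with
    | nil =>
      simp only [Phase.rank, true_and, Mem.addAll, List.length_nil]
      omega
    | cons a L =>
      simp only [Phase.rank, true_and, List.length_cons]
      omega
  | _ => cases hog

/-! ### König's lemma -/

/-- An infinite forest on the natural numbers with finitely many roots and finitely many children at
each node has an infinite branch. -/
theorem exists_infinite_branch {R : ℕ → ℕ → Prop} {m : ℕ}
    (hfin : ∀ k, {l | R k l}.Finite) (hpar : ∀ l, m ≤ l → ∃ k < l, R k l) :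
    ∃ k : ℕ → ℕ, ∀ a, R (k a) (k (a + 1)) := by
  have hroot : ∀ l, ∃ r < m, Relation.ReflTransGen R r l := by
    intro l
    induction l using Nat.strong_induction_on with
    | _ l ih =>
      rcases lt_or_ge l m with h | h
      · exact ⟨l, h, .refl⟩
      · obtain ⟨k, hk, hR⟩ := hpar l h
        obtain ⟨r, hr, hrk⟩ := ih k hk
        exact ⟨r, hr, hrk.tail hR⟩
  let D : ℕ → Set ℕ := fun k => {l | Relation.ReflTransGen R k l}
  have hstart : ∃ r, (D r).Infinite := by
    by_contra! h
    refine Set.infinite_univ (α := ℕ) (((Set.finite_lt_nat m).biUnion fun r _ =>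
      h r).subset fun l _ => ?_)
    obtain ⟨r, hr, hrl⟩ := hroot l
    exact Set.mem_biUnion (show r ∈ {i | i < m} from hr) hrl
  -- The descendants of `k` are `k` and those of its finitely many children, so some child inherits
  -- infinitely many.
  have hnext : ∀ k : {k // (D k).Infinite}, ∃ l : {k // (D k).Infinite}, R k l := by
    rintro ⟨k, hk⟩
    by_contra! h
    have hD : (⋃ l ∈ {l | R k l}, D l).Finite := (hfin k).biUnion fun l hl => by
      by_contra hinf
      exact h ⟨l, hinf⟩ hl
    refine hk ((hD.insert k).subset fun l hl => ?_)
    rcases Relation.ReflTransGen.cases_head hl with rfl | ⟨c, hc, hcl⟩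
    · exact Set.mem_insert _ _
    · exact Set.mem_insert_of_mem _ (Set.mem_biUnion (show c ∈ {l | R k l} from hc) hcl)
  obtain ⟨r, hr⟩ := hstart
  choose next hR using hnext
  exact ⟨fun a => (next^[a] ⟨r, hr⟩ : {k // (D k).Infinite}), fun a => by
    dsimp only
    rw [Function.iterate_succ_apply']
    exact hR _⟩

/-! ### The forest of an infinite execution -/

namespace IsInfiniteExecution

variable {m : ℕ} {f : Fin m → MvPolynomial (Fin n) K} {s : ℕ → State n K} {e : ℕ → Option (Gen n)}

theorem good (hrun : IsInfiniteExecution ord f s e) (hf : ∀ i, f i ≠ 0) (t : ℕ) :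
    (s t).Good ord m := by
  induction t with
  | zero => rw [hrun.init]; exact State.Good.init hf
  | succ t ih => exact ih.of_step (hrun.step t)

theorem N_mono (hrun : IsInfiniteExecution ord f s e) : Monotone fun t => (s t).mem.N :=
  monotone_nat_of_le_succ fun t => (hrun.step t).N_le

theorem S_eq (hrun : IsInfiniteExecution ord f s e) {t t' k : ℕ} (htt' : t ≤ t')
    (hk : k < (s t).mem.N) : (s t').mem.S k = (s t).mem.S k := by
  induction t', htt' using Nat.le_induction with
  | base => rfl
  | succ t' h ih => rw [(hrun.step t').S_eq (hk.trans_le (hrun.N_mono h)), ih]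

/-- Otherwise `N` is constant from time `T` on, so the measures all lie in one well-founded order
and would descend forever. -/
theorem exists_gen (hrun : IsInfiniteExecution ord f s e) (hf : ∀ i, f i ≠ 0) (T : ℕ) :
    ∃ t ≥ T, ∃ g, e t = some g := by
  by_contra! h
  have hnone : ∀ t, e (T + t) = none := fun t =>
    Option.eq_none_iff_forall_ne_some.mpr (h _ (Nat.le_add_right _ _))
  have hstep : ∀ t, Step ord (s (T + t)) none (s (T + t + 1)) := fun t => by
    simpa only [hnone] using hrun.step (T + t)
  have hN : ∀ t, (s (T + t)).mem.N = (s T).mem.N := by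
    intro t
    induction t with
    | zero => rfl
    | succ t ih => rw [← ih]; exact (hstep t).N_eq
  refine not_strictAnti_of_wellFoundedLT (fun t => (s (T + t)).rank ord (s T).mem.N)
    (strictAnti_nat_of_succ_lt fun t => ?_)
  have := (hstep t).rank_lt (hrun.good hf _)
  rwa [hN] at this

theorem exists_lt_N (hrun : IsInfiniteExecution ord f s e) (hf : ∀ i, f i ≠ 0) (l : ℕ) :
    ∃ t, l < (s t).mem.N := by
  induction l with
  | zero =>
    obtain ⟨t, -, g, hg⟩ := hrun.exists_gen hf 0
    have := ((hg ▸ hrun.step t :) : Step ord (s t) (some g) _).gen (hrun.good hf t)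
    exact ⟨t + 1, by omega⟩
  | succ l ih =>
    obtain ⟨T, hT⟩ := ih
    obtain ⟨t, hTt, g, hg⟩ := hrun.exists_gen hf T
    have := ((hg ▸ hrun.step t :) : Step ord (s t) (some g) _).gen (hrun.good hf t)
    have := hrun.N_mono hTt
    exact ⟨t + 1, by dsimp only at this; omega⟩

theorem exists_generatedFrom (hrun : IsInfiniteExecution ord f s e) (hf : ∀ i, f i ≠ 0) {l : ℕ}
    (hl : m ≤ l) : ∃ k < l, GeneratedFrom ord s e l k := by
  classical
  have hex := hrun.exists_lt_N hf l
  -- The first moment at which position `l` exists is not the start, where `N = m ≤ l`; the step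
  -- leading to it generated `r_l`.
  obtain ⟨t, ht⟩ : ∃ t, Nat.find hex = t + 1 := by
    refine Nat.exists_eq_succ_of_ne_zero fun h0 => ?_
    have := Nat.find_spec hex
    rw [h0, hrun.init] at this
    exact absurd this (not_lt.mpr hl)
  have hlt : l < (s (t + 1)).mem.N := ht ▸ Nat.find_spec hex
  have hle : (s t).mem.N ≤ l := not_lt.mp (Nat.find_min hex (by omega))
  have hstep := hrun.step t
  cases hg : e t with
  | none =>
    rw [hg] at hstep
    have := hstep.N_eq
    omega
  | some g =>
    rw [hg] at hstep
    obtain ⟨h₁, h₂, h₃, h₄, -, h₅, h₆, h₇⟩ := hstep.gen (hrun.good hf t)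
    obtain rfl : g.new = l := by omega
    exact ⟨g.hi, by omega, t, g.u, g.v, g.lo, hg, h₃, h₄, h₁, by omega, h₅, h₆, h₇⟩

theorem finite_generatedFrom (hrun : IsInfiniteExecution ord f s e) (hf : ∀ i, f i ≠ 0) (k : ℕ) :
    {l | GeneratedFrom ord s e l k}.Finite := by
  by_contra hinf
  obtain ⟨l, hl, hgen⟩ : ∃ l : ℕ → ℕ, StrictMono l ∧ ∀ a, GeneratedFrom ord s e (l a) k :=
    ⟨_, Nat.nth_strictMono hinf, fun a => Nat.nth_mem_of_infinite hinf a⟩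
  choose t u v j he hk hj hN hN' hS hlt hsp using hgen
  -- Dickson's lemma for the multipliers of the children.
  obtain ⟨a, b, hab, hu⟩ := wellQuasiOrdered_le u
  have hlab : l a < l b := hl hab
  -- Positions are assigned in order of generation, so the rule of `l a` already exists when `l b`
  -- is generated.
  have hta : t a + 1 ≤ t b := by
    by_contra hcon
    have := hrun.N_mono (show t b ≤ t a by omega)
    dsimp only at this
    have := hN a
    have := hN b
    omega
  have hstep := hrun.step (t b)
  rw [he] at hstep
  refine (hstep.gen (hrun.good hf _)).2.2.2.2.1 ?_
  have hSa : (s (t b)).mem.S (l a) = ((s (t b)).mem.S k).mul (u a) := by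
    rw [hrun.S_eq hta (by rw [hN']; exact Nat.lt_succ_self _), hS,
      hrun.S_eq hta ((hk a).trans_le (hrun.N_mono (Nat.le_succ _)))]
  refine (hrun.good hf (t b)).mem.rewritten (l := l a) ?_ ?_ ?_ ?_ ?_
  · rw [hN a]; exact (hrun.good hf _).mem.le
  · rw [← hN b]; exact hlab
  · rw [hN a]; exact hk a
  · rw [hSa]; rfl
  · rw [hSa]; exact add_le_add_left hu _

end IsInfiniteExecution

theorem GeneratedFrom.lt {s : ℕ → State n K} {e : ℕ → Option (Gen n)} {l k : ℕ}
    (h : GeneratedFrom ord s e l k) : k < l := by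
  obtain ⟨t, u, v, j, -, hk, -, rfl, -⟩ := h
  exact hk

theorem GeneratedFrom.dvd {m : ℕ} {f : Fin m → MvPolynomial (Fin n) K} {s : ℕ → State n K}
    {e : ℕ → Option (Gen n)} (hrun : IsInfiniteExecution ord f s e) {l k : ℕ}
    (h : GeneratedFrom ord s e l k) {t : ℕ} (ht : l < (s t).mem.N) :
    ((s t).mem.S k).Dvd ((s t).mem.S l) := by
  obtain ⟨t₀, u, v, j, -, hk, -, hl, hN, hS, -⟩ := h
  have ht₀ : t₀ + 1 ≤ t := by
    by_contra hcon
    have := hrun.N_mono (show t ≤ t₀ by omega)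
    dsimp only at this
    omega
  refine ⟨u, ?_⟩
  rw [hrun.S_eq ht₀ (by omega), hrun.S_eq ht₀ (by omega), hS]

end

end F5

theorem mainTheorem7 {K : Type*} [Field K] {n m : ℕ} (ord : MonomialOrder (Fin n))
    (f : Fin m → MvPolynomial (Fin n) K)
    (hf : ∀ i, f i ≠ 0) (hom : ∀ i, ∃ d : ℕ, (f i).IsHomogeneous d)
    (s : ℕ → F5.State n K) (e : ℕ → Option (F5.Gen n))
    (hrun : F5.IsInfiniteExecution ord f s e) :
    ∃ k : ℕ → ℕ, F5.IsInfiniteSPairChain ord s e k := by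
  obtain ⟨k, hk⟩ := F5.exists_infinite_branch (R := fun k l => F5.GeneratedFrom ord s e l k)
    (hrun.finite_generatedFrom hf) fun l hl => hrun.exists_generatedFrom hf hl
  exact ⟨k, strictMono_nat_of_lt_succ fun a => (hk a).lt, hk, fun a t ht => (hk a).dvd hrun ht⟩
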